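/- Let $d\ge 2$ and let $\mathbb{S}^d$ be the unit sphere of $\mathbb{R}^{d+1}$, with normalized uniform surface area measure $\sigma_d$ and total surface area $\omega_d$; put $$C_d=\frac1d\,\frac{\omega_{d-1}}{\omega_d}=\frac1d\,\frac{\Gamma\left(\frac{d+1}{2}\right)}{\sqrt{\pi}\,\Gamma\left(\frac d2\right)} .$$ For $x\in\mathbb{S}^d$ and $t\in[-1,1]$ let $C(x,t)=\{z\in\mathbb{S}^d: z\cdot x\ge t\}$, and define the spherical cap $\mathbb{L}_2$-discrepancy of points $x_1,\dots,x_N\in\mathbb{S}^d$ by $$D(x_1,\dots,x_N)=\left(\int_{-1}^1\int_{\mathbb{S}^d}\left|\frac{|\{k: x_k\in C(x,t)\}|}{N}-\sigma_d(C(x,t))\right|^2\,d\sigma_d(x)\,dt\right)^{1/2}.$$ Then for every $N\ge 2$ and all $x_1,\dots,x_N\in\mathbb{S}^d$ (not necessarily distinct), $$D(x_1,\dots,x_N)^2\ \ge\ \frac{C_d}{4\sqrt2}\left(\frac1{N^2}\sum_{j,k=1}^N (x_j\cdot x_k)^2-\frac1{d+1}\right).$$ -/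

import Mathlib

open MeasureTheory

noncomputable section

namespace SphericalDiscrepancy

/-- The unit sphere `𝕊^d` of the Euclidean space `ℝ^(d+1)`. -/
abbrev Sph (d : ℕ) : Type :=
  Metric.sphere (0 : EuclideanSpace ℝ (Fin (d + 1))) 1

/-- The surface area measure on `𝕊^d`, not normalized. -/
def surfaceMeasure (d : ℕ) : Measure (Sph d) :=
  (volume : Measure (EuclideanSpace ℝ (Fin (d + 1)))).toSphere

/-- The total surface area `ω_d` of `𝕊^d`. -/
def surfaceArea (d : ℕ) : ℝ := (surfaceMeasure d).real Set.univ

/-- The normalized uniform surface area measure `σ_d` on `𝕊^d`. -/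
def sigma (d : ℕ) : Measure (Sph d) :=
  (surfaceMeasure d Set.univ)⁻¹ • surfaceMeasure d

/-- The scalar product `x · y` in `ℝ^(d+1)` of two points of `𝕊^d`. -/
def dot {d : ℕ} (x y : Sph d) : ℝ :=
  inner ℝ (x : EuclideanSpace ℝ (Fin (d + 1))) (y : EuclideanSpace ℝ (Fin (d + 1)))

/-- The spherical cap `C(x, t) = {z ∈ 𝕊^d : z · x ≥ t}`. -/
def cap {d : ℕ} (x : Sph d) (t : ℝ) : Set (Sph d) := {z | t ≤ dot z x}

/-- The spherical cap `𝕃₂`-discrepancy of the points `p 0, …, p (N - 1)` of `𝕊^d`, which are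
counted with multiplicity. -/
def capDiscrepancy {d N : ℕ} (p : Fin N → Sph d) : ℝ :=
  Real.sqrt (∫ t in (-1 : ℝ)..1, ∫ x,
    |(({k : Fin N | p k ∈ cap x t}.ncard : ℝ) / (N : ℝ)) - (sigma d).real (cap x t)| ^ 2
      ∂(sigma d))

/-- The constant `C_d = (1 / d) * ω_(d-1) / ω_d`, for `d ≥ 1`. -/
def stolarskyConst (d : ℕ) : ℝ :=
  1 / (d : ℝ) * (surfaceArea (d - 1) / surfaceArea d)

end SphericalDiscrepancy

end

namespace SphericalDiscrepancy

noncomputable section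

open Metric Set Filter Topology Polynomial
open scoped Pointwise

/-! Stolarsky's invariance principle (`capDiscrepancy_sq`) says that D² is C_d times the mean
chordal distance over the sphere minus that over the points. As |x - y| = √2 √(1 - x·y), D² is √2
C_d times the `zonalEnergy` of 1 - √(1 - u), where the energy of φ is the mean of φ(x·y) over the
points minus its mean over the sphere. Every power u^n has nonnegative energy
(`zonalEnergy_pow_nonneg`), and 1 - √(1 - u) = u/2 + u²/8 + ... has nonnegative Taylor coefficients.
Keeping only the quadratic term bounds D² below by √2 C_d / 8 = C_d / (4√2) times the energy of u²,
whose spherical mean is 1/(d + 1). Instead of the Taylor series, the proof uses polynomials from a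
fixed-point iteration (`sqrtApprox`). -/

/-! ### Rotation invariance of the surface measure. -/

/-- The action of a linear isometry on the unit sphere. -/
def sphereEquiv {d : ℕ}
    (e : EuclideanSpace ℝ (Fin (d + 1)) ≃ₗᵢ[ℝ] EuclideanSpace ℝ (Fin (d + 1))) :
    Sph d ≃ᵐ Sph d where
  toFun x := ⟨e x, by simp⟩
  invFun x := ⟨e.symm x, by simp⟩
  left_inv x := by ext1; simp
  right_inv x := by ext1; simp
  measurable_toFun := by
    apply Continuous.measurable
    simp only [Equiv.coe_fn_mk]
    fun_prop
  measurable_invFun := by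
    apply Continuous.measurable
    simp only [Equiv.coe_fn_symm_mk]
    fun_prop

@[simp]
theorem coe_sphereEquiv {d : ℕ}
    (e : EuclideanSpace ℝ (Fin (d + 1)) ≃ₗᵢ[ℝ] EuclideanSpace ℝ (Fin (d + 1))) (x : Sph d) :
    (sphereEquiv e x : EuclideanSpace ℝ (Fin (d + 1))) = e x := rfl

theorem measurePreserving_sphereEquiv_surfaceMeasure {d : ℕ}
    (e : EuclideanSpace ℝ (Fin (d + 1)) ≃ₗᵢ[ℝ] EuclideanSpace ℝ (Fin (d + 1))) :
    MeasurePreserving (sphereEquiv e) (surfaceMeasure d) (surfaceMeasure d) := by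
  refine ⟨(sphereEquiv e).measurable, ?_⟩
  ext s hs
  rw [Measure.map_apply (sphereEquiv e).measurable hs, surfaceMeasure,
    Measure.toSphere_apply' _ hs,
    Measure.toSphere_apply' _ ((sphereEquiv e).measurable hs)]
  -- Surface measure is a multiple of the volume of the cone over a set, and `e` commutes with
  -- forming cones.
  have h : (Ioo (0 : ℝ) 1 • (Subtype.val '' (sphereEquiv e ⁻¹' s)) :
      Set (EuclideanSpace ℝ (Fin (d + 1)))) =
      e.toMeasurableEquiv ⁻¹' (Ioo (0 : ℝ) 1 • (Subtype.val '' s)) := by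
    ext v
    constructor
    · rintro ⟨r, hr, _, ⟨x, hx, rfl⟩, rfl⟩
      exact ⟨r, hr, _, ⟨_, hx, rfl⟩, by simp⟩
    · rintro ⟨r, hr, _, ⟨x, hx, rfl⟩, hv⟩
      refine ⟨r, hr, _, ⟨(sphereEquiv e).symm x, by simpa using hx, rfl⟩, ?_⟩
      apply e.injective
      have h1 : e ((sphereEquiv e).symm x : Sph d) = x := by
        rw [← coe_sphereEquiv, MeasurableEquiv.apply_symm_apply]
      simp only [map_smul, h1]
      exact hv
  rw [h, MeasurePreserving.measure_preimage_equiv]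
  exact e.measurePreserving

theorem measurePreserving_sphereEquiv {d : ℕ}
    (e : EuclideanSpace ℝ (Fin (d + 1)) ≃ₗᵢ[ℝ] EuclideanSpace ℝ (Fin (d + 1))) :
    MeasurePreserving (sphereEquiv e) (sigma d) (sigma d) :=
  (measurePreserving_sphereEquiv_surfaceMeasure e).smul_measure _

/-- The reflection in the hyperplane orthogonal to x - y swaps the two vectors, since they have
equal norm. -/
theorem exists_sphereEquiv_apply_eq {d : ℕ} (x y : Sph d) :
    ∃ e : EuclideanSpace ℝ (Fin (d + 1)) ≃ₗᵢ[ℝ] EuclideanSpace ℝ (Fin (d + 1)),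
      sphereEquiv e x = y := by
  refine ⟨_, Subtype.ext (Submodule.reflection_sub (v := (x : EuclideanSpace ℝ (Fin (d + 1))))
    (w := y) (by simp))⟩

instance instIsFiniteMeasureSurfaceMeasure (d : ℕ) : IsFiniteMeasure (surfaceMeasure d) := by
  unfold surfaceMeasure; infer_instance

theorem surfaceMeasure_univ_ne_zero (d : ℕ) : surfaceMeasure d univ ≠ 0 := by
  simpa [surfaceMeasure] using (measure_ball_pos volume _ one_pos).ne'

instance instIsProbabilityMeasureSigma (d : ℕ) : IsProbabilityMeasure (sigma d) := by
  refine ⟨?_⟩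
  rw [sigma, Measure.smul_apply, smul_eq_mul]
  exact ENNReal.inv_mul_cancel (surfaceMeasure_univ_ne_zero d) (measure_ne_top _ _)

theorem dot_comm {d : ℕ} (x y : Sph d) : dot x y = dot y x := real_inner_comm _ _

theorem dot_sphereEquiv {d : ℕ}
    (e : EuclideanSpace ℝ (Fin (d + 1)) ≃ₗᵢ[ℝ] EuclideanSpace ℝ (Fin (d + 1))) (x y : Sph d) :
    dot (sphereEquiv e x) (sphereEquiv e y) = dot x y := by
  simp [dot]

/-- The integral of a zonal function does not depend on its pole. -/
theorem integral_comp_dot_eq {d : ℕ} (φ : ℝ → ℝ) (x y : Sph d) :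
    ∫ z, φ (dot z x) ∂(sigma d) = ∫ z, φ (dot z y) ∂(sigma d) := by
  obtain ⟨e, rfl⟩ := exists_sphereEquiv_apply_eq x y
  rw [← (measurePreserving_sphereEquiv e).integral_comp' (fun z => φ (dot z (sphereEquiv e x)))]
  simp only [dot_sphereEquiv]

theorem abs_dot_le_one {d : ℕ} (x y : Sph d) : |dot x y| ≤ 1 := by
  simpa [dot] using abs_real_inner_le_norm (x : EuclideanSpace ℝ (Fin (d + 1))) y

theorem continuous_dot {d : ℕ} : Continuous fun q : Sph d × Sph d => dot q.1 q.2 := by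
  unfold dot; fun_prop


/-! ### Chordal distance, surface areas and the mean of |x · v|. -/

theorem norm_sub_eq_sqrt {d : ℕ} (x y : Sph d) :
    ‖(x : EuclideanSpace ℝ (Fin (d + 1))) - y‖ = Real.sqrt 2 * Real.sqrt (1 - dot x y) := by
  rw [← Real.sqrt_mul (by norm_num), ← Real.sqrt_sq (norm_nonneg _), norm_sub_sq_real]
  simp only [norm_eq_of_mem_sphere, dot]
  congr 1
  ring

/-- Integration in polar coordinates of a positively homogeneous function of degree one against
a radial weight. -/
theorem integral_homogeneous_mul_radial {d : ℕ} (f : EuclideanSpace ℝ (Fin (d + 1)) → ℝ)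
    (hf : ∀ r : ℝ, 0 < r → ∀ x, f (r • x) = r * f x) (g : ℝ → ℝ) :
    ∫ x, f x * g ‖x‖ =
      (∫ x : Sph d, f x ∂(surfaceMeasure d)) * ∫ r in Ioi (0 : ℝ), r ^ d * (r * g r) := by
  have hdim : Module.finrank ℝ (EuclideanSpace ℝ (Fin (d + 1))) - 1 = d := by simp
  calc
    ∫ x, f x * g ‖x‖
      = ∫ x : ({(0)}ᶜ : Set (EuclideanSpace ℝ (Fin (d + 1)))), f x.1 * g ‖x.1‖
          ∂((volume : Measure (EuclideanSpace ℝ (Fin (d + 1)))).comap Subtype.val) := by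
      rw [integral_subtype_comap (measurableSet_singleton _).compl fun x ↦ f x * g ‖x‖,
        restrict_compl_singleton]
    _ = ∫ q : Sph d × Ioi (0 : ℝ), f q.1 * (q.2 * g q.2)
          ∂((surfaceMeasure d).prod (Measure.volumeIoiPow d)) := by
      have h := (volume : Measure
        (EuclideanSpace ℝ (Fin (d + 1)))).measurePreserving_homeomorphUnitSphereProd.integral_comp
        (Homeomorph.measurableEmbedding _)
        (fun q : Sph d × Ioi (0 : ℝ) => f q.1 * ((q.2 : ℝ) * g q.2))
      rw [hdim] at h
      rw [surfaceMeasure, ← h]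
      refine integral_congr_ae (.of_forall fun x => ?_)
      have hx : (0 : ℝ) < ‖x.1‖ := norm_pos_iff.2 x.2
      have h1 : f x.1 = ‖x.1‖ * f (‖x.1‖⁻¹ • x.1) := by
        rw [← hf _ hx, smul_smul, mul_inv_cancel₀ hx.ne', one_smul]
      simp only [homeomorphUnitSphereProd_apply_snd_coe, homeomorphUnitSphereProd_apply_fst_coe]
      rw [h1]
      ring
    _ = (∫ x : Sph d, f x ∂(surfaceMeasure d)) *
          ∫ r : Ioi (0 : ℝ), (r : ℝ) * g r ∂(Measure.volumeIoiPow d) :=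
      integral_prod_mul (fun x : Sph d => f x) (fun r : Ioi (0 : ℝ) => (r : ℝ) * g r)
    _ = _ := by
      congr 1
      simp only [Measure.volumeIoiPow, ENNReal.ofReal]
      rw [integral_withDensity_eq_integral_smul,
        integral_subtype_comap measurableSet_Ioi fun a ↦ Real.toNNReal (a ^ d) • (a * g a),
        setIntegral_congr_fun measurableSet_Ioi fun x hx ↦ ?_]
      · rw [NNReal.smul_def, Real.coe_toNNReal _ (pow_nonneg (mem_Ioi.1 hx).le _), smul_eq_mul]
      · exact (measurable_subtype_coe.pow_const _).real_toNNReal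

theorem integral_abs_mul_exp_neg_sq : ∫ x : ℝ, |x| * Real.exp (-x ^ 2) = 1 := by
  have h := integral_comp_abs (f := fun x : ℝ => x * Real.exp (-x ^ 2))
  simp only [sq_abs] at h
  rw [h]
  have h2 := integral_rpow_mul_exp_neg_rpow (p := 2) (q := 1) (by norm_num) (by norm_num)
  norm_num at h2
  rw [h2]; norm_num

theorem integral_abs_apply_zero_mul_exp (d : ℕ) :
    ∫ x : EuclideanSpace ℝ (Fin (d + 1)), |x 0| * Real.exp (-‖x‖ ^ 2) =
      Real.sqrt Real.pi ^ d := by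
  rw [← (PiLp.volume_preserving_toLp (Fin (d + 1))).integral_comp
    (MeasurableEquiv.toLp 2 _).measurableEmbedding]
  have h : ∀ x : Fin (d + 1) → ℝ,
      |(WithLp.toLp 2 x) 0| * Real.exp (-‖WithLp.toLp 2 x‖ ^ 2) =
      ∏ i, (if i = 0 then fun y : ℝ => |y| * Real.exp (-y ^ 2)
        else fun y : ℝ => Real.exp (-1 * y ^ 2)) (x i) := by
    intro x
    rw [Fin.prod_univ_succ, EuclideanSpace.norm_sq_eq, Fin.sum_univ_succ, neg_add, Real.exp_add,
      ← Finset.sum_neg_distrib, Real.exp_sum]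
    simp [Fin.succ_ne_zero, mul_assoc]
  simp_rw [h]
  rw [integral_fintype_prod_volume_eq_prod, Fin.prod_univ_succ]
  simp only [if_true, Fin.succ_ne_zero, if_false, integral_abs_mul_exp_neg_sq, integral_gaussian]
  simp

theorem surfaceArea_eq (d : ℕ) :
    surfaceArea d = (d + 1) * (Real.sqrt Real.pi ^ (d + 1) / Real.Gamma ((d + 1) / 2 + 1)) := by
  have hG : 0 < Real.Gamma (((d : ℝ) + 1) / 2 + 1) := Real.Gamma_pos_of_pos (by positivity)
  rw [surfaceArea, surfaceMeasure, Measure.toSphere_real_apply_univ, Measure.real,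
    EuclideanSpace.volume_ball]
  simp only [ENNReal.ofReal_one, one_pow, one_mul, Fintype.card_fin, finrank_euclideanSpace]
  push_cast
  rw [ENNReal.toReal_ofReal (by positivity)]

theorem surfaceArea_pos (d : ℕ) : 0 < surfaceArea d := by
  have hG : 0 < Real.Gamma (((d : ℝ) + 1) / 2 + 1) := Real.Gamma_pos_of_pos (by positivity)
  rw [surfaceArea_eq]; positivity

theorem stolarskyConst_pos {d : ℕ} (hd : 1 ≤ d) : 0 < stolarskyConst d := by
  have := surfaceArea_pos d
  have := surfaceArea_pos (d - 1)
  have : (0 : ℝ) < d := by exact_mod_cast hd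
  unfold stolarskyConst; positivity

theorem integral_sigma_eq {d : ℕ} (f : Sph d → ℝ) :
    ∫ x, f x ∂(sigma d) = (surfaceArea d)⁻¹ * ∫ x, f x ∂(surfaceMeasure d) := by
  rw [sigma, integral_smul_measure, smul_eq_mul, ENNReal.toReal_inv]; rfl

/-- The first vector of the standard basis, as a point of the sphere. -/
def pole (d : ℕ) : Sph d := ⟨EuclideanSpace.single 0 1, by simp⟩

/-- The Gaussian integral of |x₀| is computed both by coordinates and in polar form. The quotient
contains π^(d/2) / Γ(d/2 + 1), the volume of the unit ball of ℝ^d, which is ω_(d-1) / d. -/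
theorem integral_abs_dot_pole {d : ℕ} (hd : 1 ≤ d) :
    ∫ x, |dot x (pole d)| ∂(sigma d) = 2 * stolarskyConst d := by
  have h := integral_homogeneous_mul_radial (d := d) (fun x => |x 0|)
    (fun r hr x => by simp [abs_mul, abs_of_pos hr]) (fun r => Real.exp (-r ^ 2))
  rw [integral_abs_apply_zero_mul_exp] at h
  have h2 : ∫ r in Ioi (0 : ℝ), r ^ d * (r * Real.exp (-r ^ 2)) =
      1 / 2 * Real.Gamma (d / 2 + 1) := by
    have h3 := integral_rpow_mul_exp_neg_rpow (p := 2) (q := d + 1) (by norm_num)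
      (by have : (0 : ℝ) ≤ d := Nat.cast_nonneg d
          linarith)
    rw [show ((d : ℝ) + 1 + 1) / 2 = d / 2 + 1 by ring] at h3
    rw [← h3]
    refine setIntegral_congr_fun measurableSet_Ioi fun r hr => ?_
    have hr : (0 : ℝ) < r := hr
    rw [Real.rpow_add_one hr.ne', Real.rpow_natCast, Real.rpow_two, mul_assoc]
  rw [h2] at h
  have hG : 0 < Real.Gamma ((d : ℝ) / 2 + 1) := Real.Gamma_pos_of_pos (by positivity)
  have h4 : ∀ x : Sph d, |dot x (pole d)| = |(x : EuclideanSpace ℝ (Fin (d + 1))) 0| := by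
    intro x; simp [dot, pole, EuclideanSpace.inner_single_right]
  simp_rw [h4]
  rw [integral_sigma_eq, stolarskyConst]
  have h5 : surfaceArea (d - 1) = d * (Real.sqrt Real.pi ^ d / Real.Gamma (d / 2 + 1)) := by
    obtain ⟨k, rfl⟩ : ∃ k, d = k + 1 := ⟨d - 1, by omega⟩
    rw [Nat.add_sub_cancel, surfaceArea_eq]; push_cast; rfl
  rw [h5, h]
  have : (0 : ℝ) < d := by exact_mod_cast hd
  have := surfaceArea_pos d
  field_simp

theorem integral_abs_inner {d : ℕ} (hd : 1 ≤ d) (v : EuclideanSpace ℝ (Fin (d + 1))) :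
    ∫ x : Sph d, |inner ℝ (x : EuclideanSpace ℝ (Fin (d + 1))) v| ∂(sigma d) =
      2 * stolarskyConst d * ‖v‖ := by
  rcases eq_or_ne v 0 with rfl | hv
  · simp
  have hv' : ‖v‖ ≠ 0 := norm_ne_zero_iff.2 hv
  let u : Sph d := ⟨‖v‖⁻¹ • v, by simp [norm_smul, hv']⟩
  have h : ∀ x : Sph d, |inner ℝ (x : EuclideanSpace ℝ (Fin (d + 1))) v| = ‖v‖ * |dot x u| := by
    intro x
    simp only [dot, u, inner_smul_right, abs_mul, abs_inv, abs_norm]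
    field_simp
  simp_rw [h]
  rw [integral_const_mul, integral_comp_dot_eq (fun t => |t|) u (pole d),
    integral_abs_dot_pole hd]
  ring

/-! ### Cap overlaps and Stolarsky's invariance principle. -/

/-- The indicator of `y ∈ cap x t`. -/
def capInd {d : ℕ} (t : ℝ) (y x : Sph d) : ℝ := if t ≤ dot y x then 1 else 0

theorem measurable_dot {α : Type*} [MeasurableSpace α] {d : ℕ} {y x : α → Sph d}
    (hy : Measurable y) (hx : Measurable x) : Measurable fun a => dot (y a) (x a) :=
  continuous_dot.measurable.comp (hy.prodMk hx)

theorem measurable_capInd {α : Type*} [MeasurableSpace α] {d : ℕ} {t : α → ℝ} {y x : α → Sph d}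
    (ht : Measurable t) (hy : Measurable y) (hx : Measurable x) :
    Measurable fun a => capInd (t a) (y a) (x a) :=
  Measurable.ite (measurableSet_le ht (measurable_dot hy hx)) measurable_const measurable_const

theorem capInd_nonneg {d : ℕ} (t : ℝ) (y x : Sph d) : 0 ≤ capInd t y x := by
  unfold capInd; split_ifs <;> norm_num

theorem capInd_le_one {d : ℕ} (t : ℝ) (y x : Sph d) : capInd t y x ≤ 1 := by
  unfold capInd; split_ifs <;> norm_num

theorem integrable_capInd_mul {α : Type*} [MeasurableSpace α] {μ : Measure α} [IsFiniteMeasure μ]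
    {d : ℕ} {t : α → ℝ} {y z x : α → Sph d} (ht : Measurable t) (hy : Measurable y)
    (hz : Measurable z) (hx : Measurable x) :
    Integrable (fun a => capInd (t a) (y a) (x a) * capInd (t a) (z a) (x a)) μ := by
  refine Integrable.of_bound
    ((measurable_capInd ht hy hx).mul (measurable_capInd ht hz hx)).aestronglyMeasurable 1
    (.of_forall fun a => ?_)
  rw [Real.norm_of_nonneg (mul_nonneg (capInd_nonneg _ _ _) (capInd_nonneg _ _ _))]
  exact mul_le_one₀ (capInd_le_one _ _ _) (capInd_nonneg _ _ _) (capInd_le_one _ _ _)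

theorem integrable_capInd {d : ℕ} (t : ℝ) (y : Sph d) :
    Integrable (fun x => capInd t y x) (sigma d) := by
  refine (integrable_capInd_mul (t := fun _ => t) (y := fun _ => y) (z := fun _ => y)
    measurable_const measurable_const measurable_const measurable_id).congr
    (.of_forall fun x => ?_)
  unfold capInd; simp

/-- The measure of the intersection of the caps of height `t` around `y` and `z`. -/
def capOverlap {d : ℕ} (t : ℝ) (y z : Sph d) : ℝ :=
  ∫ x, capInd t y x * capInd t z x ∂(sigma d)

/-- The normalized measure of a cap of height `t`. -/
def capMeasure (d : ℕ) (t : ℝ) : ℝ := ∫ x, capInd t (pole d) x ∂(sigma d)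

theorem integral_capInd_left {d : ℕ} (t : ℝ) (x : Sph d) :
    ∫ y, capInd t y x ∂(sigma d) = capMeasure d t := by
  have h : ∀ y, capInd t (pole d) y = capInd t y (pole d) := fun y => by
    unfold capInd; rw [dot_comm]
  unfold capMeasure
  simp_rw [h]
  exact integral_comp_dot_eq (fun s => if t ≤ s then 1 else 0) x (pole d)

theorem integral_capInd_right {d : ℕ} (t : ℝ) (y : Sph d) :
    ∫ x, capInd t y x ∂(sigma d) = capMeasure d t := by
  rw [← integral_capInd_left t y]
  unfold capInd; simp_rw [dot_comm y]

theorem measureReal_cap {d : ℕ} (t : ℝ) (x : Sph d) :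
    (sigma d).real (cap x t) = capMeasure d t := by
  have hm : MeasurableSet (cap x t) :=
    measurableSet_le measurable_const (measurable_dot measurable_id measurable_const)
  rw [← integral_capInd_left t x, ← integral_indicator_one hm]
  congr 1

theorem ncard_cap_eq {d N : ℕ} (p : Fin N → Sph d) (t : ℝ) (x : Sph d) :
    (({k : Fin N | p k ∈ cap x t}.ncard : ℝ)) = ∑ k, capInd t (p k) x := by
  have h : {k : Fin N | p k ∈ cap x t} =
      (Finset.univ.filter fun k : Fin N => t ≤ dot (p k) x : Finset (Fin N)) := by
    ext k; simp [cap]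
  rw [h, Set.ncard_coe_finset, Finset.card_filter]
  push_cast
  rfl

theorem integral_capOverlap_right {d : ℕ} (t : ℝ) (y : Sph d) :
    ∫ z, capOverlap t y z ∂(sigma d) = capMeasure d t ^ 2 := by
  unfold capOverlap
  rw [integral_integral_swap]
  · simp_rw [integral_const_mul, integral_capInd_left, integral_mul_const, integral_capInd_right]
    ring
  · exact integrable_capInd_mul (t := fun _ => t) (y := fun _ => y) measurable_const
      measurable_const measurable_fst measurable_snd

/-- On expanding the square, the cross term does not see the points: a cap's measure depends only on
its height. -/
theorem integral_sq_local_discrepancy {d N : ℕ} (hN : 0 < N) (p : Fin N → Sph d) (t : ℝ) :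
    ∫ x, |(({k : Fin N | p k ∈ cap x t}.ncard : ℝ) / (N : ℝ)) - (sigma d).real (cap x t)| ^ 2
      ∂(sigma d) =
    1 / (N : ℝ) ^ 2 * (∑ j, ∑ k, capOverlap t (p j) (p k)) - capMeasure d t ^ 2 := by
  have hN' : (N : ℝ) ≠ 0 := by positivity
  have h : ∀ x, |(({k : Fin N | p k ∈ cap x t}.ncard : ℝ) / (N : ℝ)) -
      (sigma d).real (cap x t)| ^ 2 =
      1 / (N : ℝ) ^ 2 * (∑ j, ∑ k, capInd t (p j) x * capInd t (p k) x) -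
      2 * capMeasure d t / N * (∑ k, capInd t (p k) x) + capMeasure d t ^ 2 := by
    intro x
    rw [sq_abs, measureReal_cap, ncard_cap_eq, ← Finset.sum_mul_sum]
    field_simp
    ring
  have hi2 : ∀ j k, Integrable (fun x => capInd t (p j) x * capInd t (p k) x) (sigma d) :=
    fun j k => integrable_capInd_mul (t := fun _ => t) (y := fun _ => p j) (z := fun _ => p k)
      measurable_const measurable_const measurable_const measurable_id
  have hI2 : Integrable (fun x => 1 / (N : ℝ) ^ 2 *
      (∑ j, ∑ k, capInd t (p j) x * capInd t (p k) x)) (sigma d) :=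
    (integrable_finsetSum _ fun j _ => integrable_finsetSum _ fun k _ => hi2 j k).const_mul _
  have hI1 : Integrable (fun x => 2 * capMeasure d t / N * (∑ k, capInd t (p k) x)) (sigma d) :=
    (integrable_finsetSum _ fun k _ => integrable_capInd t (p k)).const_mul _
  simp_rw [h]
  rw [integral_add (by exact hI2.sub hI1) (integrable_const _), integral_sub hI2 hI1, integral_const_mul,
    integral_const_mul, integral_finsetSum _ fun k _ => integrable_capInd t (p k),
    integral_finsetSum _ fun j _ => integrable_finsetSum _ fun k _ => hi2 j k]
  simp_rw [integral_finsetSum _ fun k _ => hi2 _ k, integral_capInd_right]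
  simp only [capOverlap, integral_const, Finset.sum_const, Finset.card_univ, Fintype.card_fin,
    nsmul_eq_mul, smul_eq_mul, probReal_univ, one_mul]
  field_simp
  ring

theorem setIntegral_capInd_mul {d : ℕ} (y z x : Sph d) :
    ∫ t in Ioc (-1 : ℝ) 1, capInd t y x * capInd t z x = 1 + min (dot y x) (dot z x) := by
  have hy := abs_le.1 (abs_dot_le_one y x)
  have hz := abs_le.1 (abs_dot_le_one z x)
  have h : ∀ t, capInd t y x * capInd t z x =
      (Iic (min (dot y x) (dot z x))).indicator (fun _ => (1 : ℝ)) t := by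
    intro t
    by_cases h1 : t ≤ dot y x <;> by_cases h2 : t ≤ dot z x <;> simp [capInd, h1, h2]
  simp_rw [h]
  rw [setIntegral_indicator measurableSet_Iic, Ioc_inter_Iic,
    inf_eq_right.2 (min_le_of_left_le hy.2)]
  simp only [integral_const, smul_eq_mul, mul_one, measureReal_restrict_apply_univ,
    Real.volume_real_Ioc]
  rw [max_eq_left (by linarith [le_min hy.1 hz.1])]
  ring

theorem integrable_dot_right {d : ℕ} (y : Sph d) :
    Integrable (fun x => dot y x) (sigma d) :=
  Integrable.of_bound (measurable_dot measurable_const measurable_id).aestronglyMeasurable 1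
    (.of_forall fun x => abs_dot_le_one y x)

theorem integral_dot_right {d : ℕ} (y : Sph d) : ∫ x, dot y x ∂(sigma d) = 0 := by
  have h := (measurePreserving_sphereEquiv (d := d) (LinearIsometryEquiv.neg ℝ)).integral_comp'
    (fun x => dot y x)
  have h2 : ∀ x, dot y (sphereEquiv (LinearIsometryEquiv.neg ℝ) x) = -dot y x := by
    intro x; simp [dot]
  simp_rw [h2] at h
  rw [integral_neg] at h
  linarith

/-- Integrating over t first gives 1 + min(y·x, z·x), and min(a, b) = (a + b)/2 - |a - b|/2. The
linear part averages to zero by antipodal symmetry; the rest is the mean of |x · (y - z)|. -/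
theorem setIntegral_capOverlap {d : ℕ} (hd : 1 ≤ d) (y z : Sph d) :
    ∫ t in Ioc (-1 : ℝ) 1, capOverlap t y z =
      1 - stolarskyConst d * ‖(y : EuclideanSpace ℝ (Fin (d + 1))) - z‖ := by
  unfold capOverlap
  rw [integral_integral_swap]
  · simp_rw [setIntegral_capInd_mul]
    have h : ∀ x : Sph d, 1 + min (dot y x) (dot z x) =
        1 + 1 / 2 * (dot y x + dot z x) - 1 / 2 * |inner ℝ (x : EuclideanSpace ℝ (Fin (d + 1)))
          ((y : EuclideanSpace ℝ (Fin (d + 1))) - z)| := by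
      intro x
      rw [inner_sub_right, ← show dot x y = inner ℝ (x : EuclideanSpace ℝ (Fin (d + 1))) y from rfl,
        ← show dot x z = inner ℝ (x : EuclideanSpace ℝ (Fin (d + 1))) z from rfl,
        dot_comm x y, dot_comm x z]
      rcases le_total (dot y x) (dot z x) with h | h
      · rw [min_eq_left h, abs_of_nonpos (by linarith)]; ring
      · rw [min_eq_right h, abs_of_nonneg (by linarith)]; ring
    simp_rw [h]
    have hi : Integrable (fun x => 1 / 2 * (dot y x + dot z x)) (sigma d) :=
      ((integrable_dot_right y).add (integrable_dot_right z)).const_mul (1 / 2)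
    have hi2 : Integrable (fun x : Sph d => 1 / 2 * |inner ℝ (x : EuclideanSpace ℝ (Fin (d + 1)))
          ((y : EuclideanSpace ℝ (Fin (d + 1))) - z)|) (sigma d) := by
      refine Continuous.integrable_of_hasCompactSupport (by fun_prop) (.of_compactSpace _)
    rw [integral_sub (by exact (integrable_const _).add hi) hi2, integral_add (integrable_const _) hi,
      integral_const_mul, integral_const_mul,
      integral_add (integrable_dot_right y) (integrable_dot_right z), integral_dot_right,
      integral_dot_right, integral_abs_inner hd]
    simp
    ring
  · exact integrable_capInd_mul (y := fun _ => y) (z := fun _ => z) measurable_fst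
      measurable_const measurable_const measurable_snd

/-- Stolarsky's invariance principle. -/
theorem capDiscrepancy_sq {d N : ℕ} (hd : 1 ≤ d) (hN : 0 < N) (p : Fin N → Sph d) :
    capDiscrepancy p ^ 2 = stolarskyConst d *
      ((∫ z : Sph d, ‖(z : EuclideanSpace ℝ (Fin (d + 1))) - pole d‖ ∂(sigma d)) -
        1 / (N : ℝ) ^ 2 * ∑ j, ∑ k, ‖(p j : EuclideanSpace ℝ (Fin (d + 1))) - p k‖) := by
  have hN' : (N : ℝ) ≠ 0 := by positivity
  rw [capDiscrepancy, Real.sq_sqrt (intervalIntegral.integral_nonneg (by norm_num)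
    fun t _ => integral_nonneg fun x => by positivity)]
  simp_rw [integral_sq_local_discrepancy hN]
  rw [intervalIntegral.integral_of_le (by norm_num)]
  have hi : ∀ y z : Sph d, Integrable (fun t => capOverlap t y z)
      (volume.restrict (Ioc (-1 : ℝ) 1)) := fun y z =>
    (integrable_capInd_mul (μ := (volume.restrict (Ioc (-1 : ℝ) 1)).prod (sigma d))
      (y := fun _ => y) (z := fun _ => z) measurable_fst measurable_const measurable_const
      measurable_snd).integral_prod_left
  have hi2 : Integrable (fun q : ℝ × Sph d => capOverlap q.1 (pole d) q.2)
      ((volume.restrict (Ioc (-1 : ℝ) 1)).prod (sigma d)) :=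
    (integrable_capInd_mul (μ := ((volume.restrict (Ioc (-1 : ℝ) 1)).prod (sigma d)).prod (sigma d))
      (t := fun a => a.1.1) (y := fun _ => pole d) (z := fun a => a.1.2)
      (measurable_fst.comp measurable_fst) measurable_const (measurable_snd.comp measurable_fst)
      measurable_snd).integral_prod_left
  -- The squared cap measure becomes a mean of overlaps, so `setIntegral_capOverlap` evaluates both
  -- terms and their constants 1 cancel.
  simp_rw [← integral_capOverlap_right _ (pole d)]
  rw [integral_sub ((integrable_finsetSum _ fun j _ => integrable_finsetSum _ fun k _ =>
    hi (p j) (p k)).const_mul _) hi2.integral_prod_left, integral_const_mul,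
    integral_finsetSum _ fun j _ => integrable_finsetSum _ fun k _ => hi (p j) (p k),
    integral_integral_swap hi2]
  simp_rw [integral_finsetSum _ fun k _ => hi _ (p k), setIntegral_capOverlap hd]
  have hc : Integrable (fun z : Sph d => stolarskyConst d *
      ‖(pole d : EuclideanSpace ℝ (Fin (d + 1))) - z‖) (sigma d) :=
    Continuous.integrable_of_hasCompactSupport (by fun_prop) (.of_compactSpace _)
  rw [integral_sub (integrable_const _) hc, integral_const_mul]
  simp_rw [norm_sub_rev (pole d : EuclideanSpace ℝ (Fin (d + 1))), Finset.sum_sub_distrib,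
    ← Finset.mul_sum]
  simp
  field_simp
  ring

/-! ### Positivity of zonal energies. -/

/-- The difference of the mean of a zonal kernel over the points and over the sphere. -/
def zonalEnergy {d N : ℕ} (p : Fin N → Sph d) (φ : ℝ → ℝ) : ℝ :=
  1 / (N : ℝ) ^ 2 * (∑ j, ∑ k, φ (dot (p j) (p k))) - ∫ z, φ (dot z (pole d)) ∂(sigma d)

theorem integrable_of_continuous {d : ℕ} {f : Sph d → ℝ} (hf : Continuous f) :
    Integrable f (sigma d) :=
  hf.integrable_of_hasCompactSupport (.of_compactSpace _)

theorem continuous_comp_dot_left {d : ℕ} {φ : ℝ → ℝ} (hφ : Continuous φ) (x : Sph d) :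
    Continuous fun z => φ (dot z x) :=
  hφ.comp (continuous_dot.comp (by fun_prop : Continuous fun z : Sph d => (z, x)))

/-- The monomial in the coordinates with the given list of indices. -/
def coordMonomial {d n : ℕ} (f : Fin n → Fin (d + 1)) (x : Sph d) : ℝ :=
  ∏ i, (x : EuclideanSpace ℝ (Fin (d + 1))) (f i)

theorem continuous_coordMonomial {d n : ℕ} (f : Fin n → Fin (d + 1)) :
    Continuous (coordMonomial (d := d) f) := by
  unfold coordMonomial; fun_prop

theorem dot_pow_eq_sum {d : ℕ} (n : ℕ) (x y : Sph d) :
    dot x y ^ n = ∑ f : Fin n → Fin (d + 1), coordMonomial f x * coordMonomial f y := by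
  simp_rw [coordMonomial, ← Finset.prod_mul_distrib]
  rw [← Fintype.sum_pow (fun i => (x : EuclideanSpace ℝ (Fin (d + 1))) i *
    (y : EuclideanSpace ℝ (Fin (d + 1))) i), dot, PiLp.inner_apply]
  simp [mul_comm]

/-- Since (x·y)^n is the scalar product of the tensor powers of x and y, the energy is the squared
distance between the mean tensor `a` of the points and the mean tensor `c` of the sphere. -/
theorem zonalEnergy_pow_nonneg {d N : ℕ} (hN : 0 < N) (p : Fin N → Sph d) (n : ℕ) :
    0 ≤ zonalEnergy p (fun u => u ^ n) := by
  have hN' : (N : ℝ) ≠ 0 := by positivity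
  set K := ∫ z, dot z (pole d) ^ n ∂(sigma d) with hK
  let c : (Fin n → Fin (d + 1)) → ℝ := fun f => ∫ x, coordMonomial f x ∂(sigma d)
  let a : (Fin n → Fin (d + 1)) → ℝ := fun f => 1 / (N : ℝ) * ∑ j, coordMonomial f (p j)
  -- Rotation invariance makes the pairing of `c` with any tensor power constant; averaging it over
  -- the sphere or over the points gives `h2` and `h4`.
  have h1 : ∀ y : Sph d, ∑ f, c f * coordMonomial f y = K := by
    intro y
    rw [hK, integral_comp_dot_eq (fun u => u ^ n) (pole d) y]
    simp_rw [dot_pow_eq_sum]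
    rw [integral_finsetSum _ fun f _ =>
      (integrable_of_continuous (continuous_coordMonomial f)).mul_const _]
    simp_rw [integral_mul_const]
    rfl
  have h2 : ∑ f, c f * c f = K := by
    have h3 : ∫ y, ∑ f, c f * coordMonomial f y ∂(sigma d) = K := by
      simp_rw [h1]; simp
    rw [integral_finsetSum _ fun f _ =>
      (integrable_of_continuous (continuous_coordMonomial f)).const_mul _] at h3
    simp_rw [integral_const_mul] at h3
    exact h3
  have h4 : ∑ f, c f * a f = K := by
    have h5 : ∑ j : Fin N, ∑ f, c f * coordMonomial f (p j) = N * K := by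
      simp_rw [h1]; simp
    rw [Finset.sum_comm] at h5
    simp_rw [← Finset.mul_sum] at h5
    simp only [a, mul_left_comm _ (1 / (N : ℝ)), ← Finset.mul_sum, h5]
    field_simp
  have h6 : 1 / (N : ℝ) ^ 2 * (∑ j, ∑ k, dot (p j) (p k) ^ n) = ∑ f, a f * a f := by
    have h7 : ∀ f, a f * a f =
        1 / (N : ℝ) ^ 2 * ∑ j, ∑ k, coordMonomial f (p j) * coordMonomial f (p k) := by
      intro f
      rw [← Finset.sum_mul_sum]
      simp only [a]; ring
    simp_rw [h7, ← Finset.mul_sum, dot_pow_eq_sum]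
    congr 1
    symm
    rw [Finset.sum_comm]
    refine Finset.sum_congr rfl fun j _ => ?_
    rw [Finset.sum_comm]
    simp_rw [Finset.mul_sum]
  have h8 : zonalEnergy p (fun u => u ^ n) = ∑ f, (a f - c f) ^ 2 := by
    have h9 : ∀ f, (a f - c f) ^ 2 = a f * a f - 2 * (c f * a f) + c f * c f := fun f => by ring
    simp_rw [h9, Finset.sum_add_distrib, Finset.sum_sub_distrib, ← Finset.mul_sum]
    rw [h2, h4, ← h6, zonalEnergy, ← hK]
    ring
  rw [h8]
  positivity

theorem zonalEnergy_sum {d N : ℕ} (p : Fin N → Sph d) {ι : Type*} (s : Finset ι) (c : ι → ℝ)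
    (φ : ι → ℝ → ℝ) (hφ : ∀ i ∈ s, Continuous (φ i)) :
    zonalEnergy p (fun u => ∑ i ∈ s, c i * φ i u) = ∑ i ∈ s, c i * zonalEnergy p (φ i) := by
  unfold zonalEnergy
  rw [integral_finsetSum _ fun i hi =>
    (integrable_of_continuous (continuous_comp_dot_left (hφ i hi) _)).const_mul _]
  simp_rw [integral_const_mul, mul_sub, Finset.sum_sub_distrib]
  congr 1
  simp_rw [mul_left_comm (c _), ← Finset.mul_sum]
  congr 1
  simp_rw [Finset.mul_sum]
  symm
  rw [Finset.sum_comm]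
  refine Finset.sum_congr rfl fun j _ => ?_
  rw [Finset.sum_comm]

theorem zonalEnergy_add {d N : ℕ} (p : Fin N → Sph d) {φ ψ : ℝ → ℝ} (hφ : Continuous φ)
    (hψ : Continuous ψ) :
    zonalEnergy p (fun u => φ u + ψ u) = zonalEnergy p φ + zonalEnergy p ψ := by
  have h := zonalEnergy_sum p Finset.univ (fun _ : Bool => 1) (fun b => cond b φ ψ)
    (by rintro (_ | _) _ <;> assumption)
  simpa using h

theorem zonalEnergy_const_mul {d N : ℕ} (p : Fin N → Sph d) {φ : ℝ → ℝ} (hφ : Continuous φ)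
    (c : ℝ) : zonalEnergy p (fun u => c * φ u) = c * zonalEnergy p φ := by
  have h := zonalEnergy_sum p Finset.univ (fun _ : Unit => c) (fun _ => φ) (fun _ _ => hφ)
  simpa using h

theorem zonalEnergy_const {d N : ℕ} (hN : 0 < N) (p : Fin N → Sph d) (c : ℝ) :
    zonalEnergy p (fun _ => c) = 0 := by
  have hN' : (N : ℝ) ≠ 0 := by positivity
  simp [zonalEnergy]
  field_simp
  ring

theorem zonalEnergy_polynomial_nonneg {d N : ℕ} (hN : 0 < N) (p : Fin N → Sph d) {P : ℝ[X]}
    (hP : ∀ k, 0 ≤ P.coeff k) : 0 ≤ zonalEnergy p (fun u => P.eval u) := by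
  simp_rw [eval_eq_sum_range]
  rw [zonalEnergy_sum p _ _ _ fun i _ => continuous_pow i]
  exact Finset.sum_nonneg fun i _ => mul_nonneg (hP i) (zonalEnergy_pow_nonneg hN p i)

/-! ### Polynomial approximation of 1 - √(1 - u). -/

/-- Polynomials with nonnegative coefficients that converge to `1 - √(1 - u)` on `[-1, 1]`. -/
def sqrtApprox : ℕ → ℝ[X]
  | 0 => 0
  | n + 1 => C (1 / 2) * (X + sqrtApprox n ^ 2)

theorem coeff_mul_nonneg {P Q : ℝ[X]} (hP : ∀ k, 0 ≤ P.coeff k) (hQ : ∀ k, 0 ≤ Q.coeff k)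
    (k : ℕ) : 0 ≤ (P * Q).coeff k := by
  rw [coeff_mul]
  exact Finset.sum_nonneg fun i _ => mul_nonneg (hP _) (hQ _)

theorem coeff_X_nonneg (k : ℕ) : 0 ≤ (X : ℝ[X]).coeff k := by
  rw [coeff_X]; split_ifs <;> norm_num

theorem coeff_sqrtApprox_nonneg (n k : ℕ) : 0 ≤ (sqrtApprox n).coeff k := by
  induction n generalizing k with
  | zero => simp [sqrtApprox]
  | succ n ih =>
    rw [sqrtApprox, coeff_C_mul, coeff_add, sq]
    exact mul_nonneg (by norm_num) (add_nonneg (coeff_X_nonneg k) (coeff_mul_nonneg ih ih k))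

theorem coeff_sqrtApprox_sub_nonneg (n k : ℕ) :
    0 ≤ (sqrtApprox (n + 2) - C (1 / 8) * X ^ 2).coeff k := by
  set R := sqrtApprox n ^ 2 with hR
  have hR0 : ∀ k, 0 ≤ R.coeff k := fun k => by
    rw [hR, sq]
    exact coeff_mul_nonneg (coeff_sqrtApprox_nonneg n) (coeff_sqrtApprox_nonneg n) k
  -- Two steps of the recursion are needed: the first produces X/2, the second squares and halves it
  -- into X²/8.
  have h : sqrtApprox (n + 2) - C (1 / 8) * X ^ 2 =
      C (1 / 2) * X + (C (1 / 4) * (X * R) + C (1 / 8) * (R * R)) := by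
    rw [sqrtApprox, sqrtApprox, ← hR]
    have h4 : (C (1 / 4) : ℝ[X]) = C (1 / 2) * C (1 / 2) := by rw [← C_mul]; norm_num
    have h8 : (C (1 / 8) : ℝ[X]) = C (1 / 2) * C (1 / 2) * C (1 / 2) := by
      rw [← C_mul, ← C_mul]; norm_num
    have h1 : (C (1 / 2) : ℝ[X]) * 2 = 1 := by
      rw [show (2 : ℝ[X]) = C 2 from (map_ofNat C 2).symm, ← C_mul]; norm_num
    rw [h4, h8]
    linear_combination (C (1 / 2) * C (1 / 2) * X * R) * h1
  rw [h]
  simp only [coeff_add, coeff_C_mul]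
  have := coeff_X_nonneg k
  have := coeff_mul_nonneg coeff_X_nonneg hR0 k
  have := coeff_mul_nonneg hR0 hR0 k
  positivity

theorem eval_sqrtApprox_succ (n : ℕ) (u : ℝ) :
    (sqrtApprox (n + 1)).eval u = (u + (sqrtApprox n).eval u ^ 2) / 2 := by
  rw [sqrtApprox]
  simp
  ring

theorem abs_eval_sqrtApprox_le {u : ℝ} (hu : |u| ≤ 1) (n : ℕ) :
    |(sqrtApprox n).eval u| ≤ 1 := by
  induction n with
  | zero => simp [sqrtApprox]
  | succ n ih =>
    rw [eval_sqrtApprox_succ]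
    have h1 := abs_le.1 hu
    have h2 := (sq_le_one_iff_abs_le_one _).2 ih
    have h3 := sq_nonneg ((sqrtApprox n).eval u)
    rw [abs_le]; constructor <;> linarith

theorem tendsto_eval_sqrtApprox {u : ℝ} (hu : |u| ≤ 1) :
    Tendsto (fun n => (sqrtApprox n).eval u) atTop (𝓝 (1 - √(1 - u))) := by
  have hu' := abs_le.1 hu
  rcases eq_or_lt_of_le hu'.2 with rfl | h1
  -- At u = 1 the contraction factor degenerates to 1, so monotone convergence to the only fixed
  -- point replaces it.
  · have hmono : Monotone fun n => (sqrtApprox n).eval (1 : ℝ) := by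
      refine monotone_nat_of_le_succ fun n => ?_
      rw [eval_sqrtApprox_succ]
      nlinarith [sq_nonneg ((sqrtApprox n).eval (1 : ℝ) - 1)]
    have hb : BddAbove (range fun n => (sqrtApprox n).eval (1 : ℝ)) :=
      ⟨1, by rintro _ ⟨n, rfl⟩; exact (abs_le.1 (abs_eval_sqrtApprox_le hu n)).2⟩
    have hl := tendsto_atTop_ciSup hmono hb
    set l := ⨆ n, (sqrtApprox n).eval (1 : ℝ)
    have h2 : Tendsto (fun n => (sqrtApprox (n + 1)).eval (1 : ℝ)) atTop (𝓝 ((1 + l ^ 2) / 2)) := by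
      simp_rw [eval_sqrtApprox_succ]
      exact ((hl.pow 2).const_add 1).div_const 2
    have h3 := tendsto_nhds_unique h2 ((tendsto_add_atTop_iff_nat 1).2 hl)
    have h4 : l = 1 := by nlinarith [sq_nonneg (l - 1)]
    rw [h4] at hl
    simpa using hl
  · set q := 1 - √(1 - u) with hq
    have hs0 : 0 < √(1 - u) := Real.sqrt_pos.2 (by linarith)
    have hs : √(1 - u) ^ 2 = 1 - u := Real.sq_sqrt (by linarith)
    have hs2 : √(1 - u) < 2 := by nlinarith
    have hq1 : |q| < 1 := by rw [abs_lt]; constructor <;> linarith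
    have hqe : q = (u + q ^ 2) / 2 := by rw [hq]; linarith
    set ρ := (1 + |q|) / 2 with hρ
    -- With q a fixed point, each step multiplies the error by half the sum of the iterate and q, at
    -- most ρ < 1 in absolute value.
    have h : ∀ n, |(sqrtApprox n).eval u - q| ≤ ρ ^ n * |q| := by
      intro n
      induction n with
      | zero => simp [sqrtApprox]
      | succ n ih =>
        have h2 : (sqrtApprox (n + 1)).eval u - q =
            ((sqrtApprox n).eval u + q) / 2 * ((sqrtApprox n).eval u - q) := by
          rw [eval_sqrtApprox_succ]; linear_combination -hqe
        rw [h2, abs_mul, pow_succ' ρ, mul_assoc]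
        refine mul_le_mul ?_ ih (abs_nonneg _) (by positivity)
        rw [abs_div, abs_two]
        have := abs_add_le ((sqrtApprox n).eval u) q
        have := abs_eval_sqrtApprox_le hu n
        rw [hρ]; linarith
    rw [tendsto_iff_norm_sub_tendsto_zero]
    refine squeeze_zero (fun _ => norm_nonneg _) h ?_
    have := (tendsto_pow_atTop_nhds_zero_of_lt_one (r := ρ) (by positivity)
      (by rw [hρ]; linarith)).mul_const |q|
    simpa using this

theorem tendsto_zonalEnergy_sqrtApprox {d N : ℕ} (p : Fin N → Sph d) :
    Tendsto (fun n => zonalEnergy p (fun u => (sqrtApprox n).eval u)) atTop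
      (𝓝 (zonalEnergy p (fun u => 1 - √(1 - u)))) := by
  unfold zonalEnergy
  refine Tendsto.sub (Tendsto.const_mul _ (tendsto_finsetSum _ fun j _ =>
    tendsto_finsetSum _ fun k _ => tendsto_eval_sqrtApprox (abs_dot_le_one _ _))) ?_
  refine tendsto_integral_of_dominated_convergence (fun _ => 1) (fun n => ?_)
    (integrable_const _) (fun n => .of_forall fun z => abs_eval_sqrtApprox_le (abs_dot_le_one _ _) n)
    (.of_forall fun z => tendsto_eval_sqrtApprox (abs_dot_le_one _ _))
  exact (integrable_of_continuous
    (continuous_comp_dot_left (sqrtApprox n).continuous _)).aestronglyMeasurable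

/-- The bound holds for each approximant from index 2 on, as removing X²/8 leaves nonnegative
coefficients; it then passes to the limit. -/
theorem zonalEnergy_sq_le {d N : ℕ} (hN : 0 < N) (p : Fin N → Sph d) :
    1 / 8 * zonalEnergy p (fun u => u ^ 2) ≤ - zonalEnergy p (fun u => √(1 - u)) := by
  have h1 : zonalEnergy p (fun u => 1 - √(1 - u)) = - zonalEnergy p (fun u => √(1 - u)) := by
    have h := zonalEnergy_add p (φ := fun _ => 1) (ψ := fun u => -1 * √(1 - u))
      (by fun_prop) (by fun_prop)
    rw [zonalEnergy_const hN, zonalEnergy_const_mul p (by fun_prop)] at h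
    simpa only [neg_one_mul, zero_add, sub_eq_add_neg] using h
  rw [← h1]
  refine ge_of_tendsto ((tendsto_add_atTop_iff_nat 2).2 (tendsto_zonalEnergy_sqrtApprox p))
    (.of_forall fun n => ?_)
  have h2 := zonalEnergy_polynomial_nonneg hN p (coeff_sqrtApprox_sub_nonneg n)
  have h3 := zonalEnergy_add p (sqrtApprox (n + 2) - C (1 / 8) * X ^ 2).continuous
    (ψ := fun u => 1 / 8 * u ^ 2) (by fun_prop)
  rw [zonalEnergy_const_mul p (by fun_prop)] at h3
  have h4 : (fun u : ℝ => (sqrtApprox (n + 2)).eval u) =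
      fun u => (sqrtApprox (n + 2) - C (1 / 8) * X ^ 2).eval u + 1 / 8 * u ^ 2 := by
    ext u; simp
  rw [h4, h3]
  linarith

/-- The d + 1 squared coordinates have equal means by rotation invariance and sum to 1. -/
theorem integral_dot_pole_sq (d : ℕ) :
    ∫ z, dot z (pole d) ^ 2 ∂(sigma d) = 1 / ((d : ℝ) + 1) := by
  let e : Fin (d + 1) → Sph d := fun i => ⟨EuclideanSpace.single i 1, by simp⟩
  have h : ∀ z : Sph d, ∑ i, dot z (e i) ^ 2 = 1 := by
    intro z
    have hz : ‖(z : EuclideanSpace ℝ (Fin (d + 1)))‖ ^ 2 = 1 := by simp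
    rw [← hz, EuclideanSpace.norm_sq_eq]
    simp [dot, e, EuclideanSpace.inner_single_right]
  have h2 : ∫ z, ∑ i, dot z (e i) ^ 2 ∂(sigma d) = 1 := by simp [h]
  rw [integral_finsetSum _ fun i _ =>
    integrable_of_continuous (continuous_comp_dot_left (continuous_pow 2) (e i))] at h2
  simp_rw [integral_comp_dot_eq (fun u => u ^ 2) _ (pole d)] at h2
  simp at h2
  field_simp
  linarith

end

end SphericalDiscrepancy

theorem mainTheorem4 (d : ℕ) (hd : 2 ≤ d) (N : ℕ) (hN : 2 ≤ N)
    (p : Fin N → SphericalDiscrepancy.Sph d) :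
    SphericalDiscrepancy.stolarskyConst d / (4 * Real.sqrt 2) *
        (1 / (N : ℝ) ^ 2 * (∑ j : Fin N, ∑ k : Fin N, SphericalDiscrepancy.dot (p j) (p k) ^ 2)
          - 1 / ((d : ℝ) + 1))
      ≤ SphericalDiscrepancy.capDiscrepancy p ^ 2 := by
  open SphericalDiscrepancy in
  have hN0 : 0 < N := by omega
  have h := zonalEnergy_sq_le hN0 p
  have hC := stolarskyConst_pos (d := d) (by omega)
  have h2 : capDiscrepancy p ^ 2 =
      stolarskyConst d * (Real.sqrt 2 * -zonalEnergy p (fun u => Real.sqrt (1 - u))) := by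
    rw [capDiscrepancy_sq (by omega) hN0]
    simp_rw [norm_sub_eq_sqrt, ← Finset.mul_sum]
    rw [integral_const_mul, zonalEnergy]
    ring
  have h3 : 1 / (N : ℝ) ^ 2 * (∑ j : Fin N, ∑ k : Fin N, dot (p j) (p k) ^ 2)
      - 1 / ((d : ℝ) + 1) = zonalEnergy p (fun u => u ^ 2) := by
    rw [zonalEnergy, integral_dot_pole_sq]
  have hs : 1 / (4 * Real.sqrt 2) = Real.sqrt 2 * (1 / 8) := by
    have := Real.mul_self_sqrt (show (0 : ℝ) ≤ 2 by norm_num)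
    field_simp
    linarith
  rw [h2, h3, div_eq_mul_one_div, hs, mul_assoc, mul_assoc]
  gcongr
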